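/- For a Boolean function $f:\{0,1\}^n\to\{0,1\}$, a quantum query algorithm with $t$ queries works in a finite-dimensional complex Hilbert space with a fixed (standard) basis, each element of which is associated with one or none of the $n$ input bits. Starting from a fixed unit vector, on input $x$ it applies $U_1,Q_x,U_2,Q_x,\dots,U_t,Q_x,U_{t+1}$, where the unitaries $U_j$ do not depend on $x$ and the query $Q_x$ multiplies a basis vector associated with the $i$-th bit by $(-1)^{x_i}$ and fixes a basis vector associated with no bit; finally it measures in the standard basis and outputs a bit determined by the result. It computes $f$ exactly if for every $x$ it outputs $f(x)$ with probability $1$. Let $Q_E(f)$ be the least number of queries of a quantum query algorithm that computes $f$ exactly. Let $\mathrm{AND}_n(x)=1$ iff all bits of $x$ are $1$, and call two $n$-bit Boolean functions isomorphic if they are equal up to permutations and negations of the input variables and negation of the output. Almost all $n$-bit Boolean functions satisfy $Q_E(f)<n$: among all $n$-bit Boolean functions $f$, the fraction of those with $Q_E(f)<n$ tends to $1$ as $n\to\infty$, and the fraction of those with $Q_E(f)=n$ is $o(1)$. Moreover, there are $2^{2^n}$ $n$-bit Boolean functions, for every $n\ge 2$ exactly $2\cdot 2^n$ of them are isomorphic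 to $\mathrm{AND}_n$, and hence the fraction of $n$-bit Boolean functions that are isomorphic to $\mathrm{AND}_n$ is $o(1)$. -/

import Mathlib

open scoped Matrix

/-- An `n`-bit Boolean function. -/
abbrev BoolFun (n : ℕ) : Type := (Fin n → Bool) → Bool

/-- `AND_n`: equal to `1` iff all input bits are `1`. -/
def andFun (n : ℕ) : BoolFun n := fun x => decide (∀ i, x i = true)

/-- `f` and `g` are (query-)isomorphic: equal up to negations and permutations of the input
variables and negation of the output. -/
def QueryIsomorphic {n : ℕ} (f g : BoolFun n) : Prop :=
  ∃ (σ : Equiv.Perm (Fin n)) (a : Fin n → Bool) (b : Bool),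
    ∀ x : Fin n → Bool, f x = xor b (g (fun i => xor (a i) (x (σ i))))

/-- A quantum query algorithm on `n` input bits, in the finite-dimensional Hilbert space whose
standard basis is indexed by `ι`. It applies `first`, and then, for every `U` in the list `rest`,
one query followed by `U`. -/
structure QueryAlgorithm (n : ℕ) (ι : Type) [Fintype ι] [DecidableEq ι] where
  /-- the starting state, independent of the input -/
  start : ι → ℂ
  start_unit : ∑ i, ‖start i‖ ^ 2 = 1
  /-- the input bit that a basis state corresponds to, or `none` -/
  label : ι → Option (Fin n)
  /-- the unitary applied before the first query -/
  first : Matrix.unitaryGroup ι ℂ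
  /-- the unitaries applied after the successive queries -/
  rest : List (Matrix.unitaryGroup ι ℂ)
  /-- the output attached to each result of the final measurement in the standard basis -/
  output : ι → Bool

namespace QueryAlgorithm

variable {n : ℕ} {ι : Type} [Fintype ι] [DecidableEq ι]

/-- The number of queries made. -/
def queries (A : QueryAlgorithm n ι) : ℕ := A.rest.length

/-- The phase that the query with input `x` gives to a basis state: `(-1)^{x_j}` if the basis state
corresponds to the bit `j`, and `1` if it corresponds to no bit. -/
def phase (A : QueryAlgorithm n ι) (x : Fin n → Bool) (i : ι) : ℂ :=
  match A.label i with
  | none => 1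
  | some j => if x j = true then -1 else 1

/-- The query transformation, diagonal in the standard basis. -/
def query (A : QueryAlgorithm n ι) (x : Fin n → Bool) : Matrix ι ι ℂ :=
  Matrix.diagonal (A.phase x)

/-- The state before the final measurement, on input `x`. -/
def finalState (A : QueryAlgorithm n ι) (x : Fin n → Bool) : ι → ℂ :=
  A.rest.foldl
    (fun (ψ : ι → ℂ) (U : Matrix.unitaryGroup ι ℂ) => (U : Matrix ι ι ℂ) *ᵥ (A.query x *ᵥ ψ))
    ((A.first : Matrix ι ι ℂ) *ᵥ A.start)

/-- The probability that the algorithm outputs `b` on input `x`. -/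
noncomputable def outputProb (A : QueryAlgorithm n ι) (x : Fin n → Bool) (b : Bool) : ℝ :=
  ∑ i with A.output i = b, ‖A.finalState x i‖ ^ 2

/-- `A` computes `f` exactly: on every input, it outputs the value of `f` with certainty. -/
def ComputesExactly (A : QueryAlgorithm n ι) (f : BoolFun n) : Prop :=
  ∀ x, A.outputProb x (f x) = 1

end QueryAlgorithm

/-- The exact quantum query complexity `Q_E(f)`: the least number of queries of a quantum query
algorithm that computes `f` exactly (it would be `⊤` if there were no such algorithm). -/
noncomputable def exactQuantumQueryComplexity {n : ℕ} (f : BoolFun n) : ℕ∞ :=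
  sInf {q : ℕ∞ | ∃ (ι : Type) (_ : Fintype ι) (_ : DecidableEq ι) (A : QueryAlgorithm n ι),
    A.ComputesExactly f ∧ q = (A.queries : ℕ∞)}

/-- The fraction of the `n`-bit Boolean functions that have the property `P`. -/
noncomputable def fractionOf (n : ℕ) (P : BoolFun n → Prop) : ℝ :=
  (Nat.card {f : BoolFun n // P f} : ℝ) / (Nat.card (BoolFun n) : ℝ)

/-! `Bool` is used as the field with two elements, so that `+` is `xor` and `∑ x, f x` is the parity
of the number of ones of `f`. The labels of the basis states are the bits and `none`, which reads
`0`.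

One query to the uniform superposition of two labels `p ≠ q` reveals the sum of the two bits that
they read, and thereby restricts `f` to one of two halves of the cube, each of which is itself a
cube with one bit less. The parity of `f` on such a half is determined by the parity of `f` and by
the bits that `p` and `q` read from `supportSum f`.

If `f` is even, then among the `n + 1` labels there are two that read the same bit of
`supportSum f`, because a bit takes only two values. Both of their halves are even, and so `n - 1`
queries suffice, by induction.

If `f` is odd, then for all `p ≠ q` the half that contains `supportSum f` is odd and the other one
is even, so it is enough to find one odd half on which `n - 2` queries suffice. For `n ≥ 4`, a
function that is a point function (isomorphic to `AND`) on every odd half is a point function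
itself, which reduces the claim to `n = 3`. There, one query to the uniform superposition of all
four labels is followed by an isometry that records the mean and the pairwise differences of the
amplitudes. Up to a translation by `supportSum f`, a nonzero difference of the amplitudes of `p` and
`q` leaves the even half of `p` and `q`, while a nonzero mean leaves the inputs of weight `0`, `1`
and `3`, on which `f` is affine in two of the bits unless it is a point function; its value is then
found with one more query.

Hence `Q_E(f) = n` forces `f` to be a point function for `n ≥ 3`, and there are only `2 * 2 ^ n`
point functions among the `2 ^ 2 ^ n` functions. -/

section PointFunction

variable {α : Type*}

/-- `f` is a point function on `S`: among the points of `S`, it takes some value exactly once. On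
the cube these are the functions isomorphic to `AND_n`. -/
def IsPointFunctionOn (f : α → Bool) (S : Set α) : Prop :=
  ∃ a ∈ S, ∀ x ∈ S, f x = f a → x = a

theorem isPointFunctionOn_univ_iff [DecidableEq α] {f : α → Bool} :
    IsPointFunctionOn f Set.univ ↔ ∃ (a : α) (b : Bool), f = fun x => xor b (decide (x = a)) := by
  constructor
  · rintro ⟨a, -, ha⟩
    refine ⟨a, !(f a), funext fun x => ?_⟩
    by_cases hx : x = a
    · simp [hx]
    · simpa [hx] using Bool.eq_not_of_ne fun h => hx (ha x trivial h)
  · rintro ⟨a, b, rfl⟩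
    exact ⟨a, trivial, fun x _ h => by simpa using Bool.xor_right_inj.mp h⟩

theorem card_isPointFunctionOn_univ [Fintype α] (hα : 2 < Fintype.card α) :
    Nat.card {f : α → Bool // IsPointFunctionOn f Set.univ} = 2 * Fintype.card α := by
  classical
  let F : Bool × α → α → Bool := fun q x => xor q.1 (decide (x = q.2))
  have hF : Function.Injective F := by
    rintro ⟨b, a⟩ ⟨b', a'⟩ h
    obtain ⟨z, -, hz⟩ := Finset.exists_mem_notMem_of_card_lt_card
      (s := {a, a'}) (t := Finset.univ) (Finset.card_le_two.trans_lt hα)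
    simp only [Finset.mem_insert, Finset.mem_singleton, not_or] at hz
    obtain rfl : b = b' := by simpa [F, hz.1, hz.2] using congrFun h z
    obtain rfl : a = a' := by simpa [F] using Bool.xor_right_inj.mp (congrFun h a)
    rfl
  have hrange : ∀ f, IsPointFunctionOn f Set.univ ↔ f ∈ Set.range F := fun f => by
    rw [isPointFunctionOn_univ_iff]
    exact ⟨fun ⟨a, b, h⟩ => ⟨(b, a), h.symm⟩, fun ⟨q, h⟩ => ⟨q.2, q.1, h.symm⟩⟩
  rw [Nat.card_congr (Equiv.subtypeEquivRight hrange), Nat.card_range_of_injective hF]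
  simp

end PointFunction

section Labels

variable {n : ℕ}

/-- The bit of `x` read by a label: bit `i` for `some i`, and `0` for `none`. -/
def labelBit (p : Option (Fin n)) (x : Fin n → Bool) : Bool := p.elim 0 x

theorem labelBit_add (p : Option (Fin n)) (x y : Fin n → Bool) :
    labelBit p (x + y) = labelBit p x + labelBit p y := by
  cases p <;> rfl

theorem labelBit_map {m : ℕ} (e : Fin m → Fin n) (p : Option (Fin m)) (x : Fin n → Bool) :
    labelBit (p.map e) x = labelBit p (x ∘ e) := by
  cases p <;> rfl

/-- The inputs for which the bits read by the labels `p` and `q` have sum `b`. -/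
def half (p q : Option (Fin n)) (b : Bool) : Set (Fin n → Bool) :=
  {x | labelBit p x + labelBit q x = b}

instance (p q : Option (Fin n)) (b : Bool) : DecidablePred (· ∈ half p q b) :=
  fun x => inferInstanceAs (Decidable (labelBit p x + labelBit q x = b))

theorem half_comm (p q : Option (Fin n)) (b : Bool) : half p q b = half q p b := by
  simp only [half, add_comm]

theorem compl_half (p q : Option (Fin n)) (b : Bool) : (half p q b)ᶜ = half p q (1 + b) := by
  ext x
  change ¬ labelBit p x + labelBit q x = b ↔ labelBit p x + labelBit q x = 1 + b
  generalize labelBit p x + labelBit q x = u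
  decide +revert

theorem exists_half_equiv_of_some (j : Fin (n + 1)) {q : Option (Fin (n + 1))} (hq : some j ≠ q)
    (b : Bool) : ∃ E : half (some j) q b ≃ (Fin n → Bool), ∀ x, E x = x.1 ∘ j.succAbove := by
  obtain ⟨r, rfl⟩ : ∃ r : Option (Fin n), q = r.map j.succAbove := by
    rcases q with _ | i
    · exact ⟨none, rfl⟩
    · obtain ⟨l, rfl⟩ := Fin.exists_succAbove_eq fun h : i = j => hq (congrArg some h.symm)
      exact ⟨some l, rfl⟩
  let extend (y : Fin n → Bool) : Fin (n + 1) → Bool :=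
    j.insertNth (α := fun _ => Bool) (b + labelBit r y) y
  have extend_comp (y : Fin n → Bool) : extend y ∘ j.succAbove = y := by
    funext i
    simp [extend]
  have extend_mem (y : Fin n → Bool) : extend y ∈ half (some j) (r.map j.succAbove) b := by
    change extend y j + labelBit (r.map j.succAbove) (extend y) = b
    rw [labelBit_map, extend_comp]
    simp only [extend, Fin.insertNth_apply_same, add_assoc, BooleanRing.add_self, add_zero]
  have extend_of_mem {x} (hx : x ∈ half (some j) (r.map j.succAbove) b) :
      extend (x ∘ j.succAbove) = x := by
    obtain rfl : x j + labelBit (r.map j.succAbove) x = b := hx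
    rw [Fin.insertNth_eq_iff, labelBit_map, add_assoc, BooleanRing.add_self, add_zero]
    exact ⟨rfl, rfl⟩
  exact ⟨⟨fun x => x.1 ∘ j.succAbove, fun y => ⟨extend y, extend_mem y⟩,
    fun x => Subtype.ext (extend_of_mem x.2), extend_comp⟩, fun _ => rfl⟩

theorem exists_half_equiv {p q : Option (Fin (n + 1))} (hpq : p ≠ q) :
    ∃ e : Fin n → Fin (n + 1), ∀ b, ∃ E : half p q b ≃ (Fin n → Bool), ∀ x, E x = x.1 ∘ e := by
  rcases p with _ | j
  · obtain ⟨j, rfl⟩ := Option.ne_none_iff_exists'.mp hpq.symm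
    exact ⟨j.succAbove, fun b => half_comm (some j) none b ▸ exists_half_equiv_of_some j hpq.symm b⟩
  · exact ⟨j.succAbove, exists_half_equiv_of_some j hpq⟩

theorem isPointFunctionOn_of_comp_equiv {α β : Type*} {f : α → Bool} {S : Set α} (E : S ≃ β)
    (h : IsPointFunctionOn (fun y => f (E.symm y)) Set.univ) : IsPointFunctionOn f S := by
  obtain ⟨a, -, ha⟩ := h
  refine ⟨E.symm a, (E.symm a).2, fun x hx hfx => ?_⟩
  have hEx : E ⟨x, hx⟩ = a := ha _ trivial (by simpa using hfx)
  simp [← hEx]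

/-- The sum of the points of the support of `f`. -/
def supportSum (f : BoolFun n) : Fin n → Bool := fun i => ∑ x, f x * x i

theorem labelBit_supportSum (p : Option (Fin n)) (f : BoolFun n) :
    labelBit p (supportSum f) = ∑ x, f x * labelBit p x := by
  cases p with
  | none => exact (Finset.sum_eq_zero fun x _ => mul_zero _).symm
  | some i => rfl

theorem sum_half (f : BoolFun n) (p q : Option (Fin n)) (b : Bool) :
    ∑ x : half p q b, f x =
      (1 + b) * ∑ x, f x + (labelBit p (supportSum f) + labelBit q (supportSum f)) := by
  have indicator (x : Fin n → Bool) : (if x ∈ half p q b then f x else 0) =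
      (1 + b) * f x + (f x * labelBit p x + f x * labelBit q x) := by
    change (if labelBit p x + labelBit q x = b then f x else 0) = _
    generalize labelBit p x = u, labelBit q x = v, f x = w
    decide +revert
  rw [← Finset.sum_subtype {x | x ∈ half p q b} (by simp) f, Finset.sum_filter]
  simp only [indicator, Finset.sum_add_distrib, ← Finset.mul_sum, labelBit_supportSum]

end Labels

section OddHalves

variable {n : ℕ}

/-- The one of the two halves defined by the labels `p` and `q` that contains `s`. -/
def halfThrough (s : Fin n → Bool) (p q : Option (Fin n)) : Set (Fin n → Bool) :=
  half p q (labelBit p s + labelBit q s)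

theorem mem_halfThrough_iff {s x : Fin n → Bool} {p q : Option (Fin n)} :
    x ∈ halfThrough s p q ↔ labelBit p (x + s) = labelBit q (x + s) := by
  simp only [halfThrough, half, Set.mem_ofPred_eq, labelBit_add]
  generalize labelBit p x = a, labelBit q x = b, labelBit p s = c, labelBit q s = d
  decide +revert

theorem mem_halfThrough_trans {s x : Fin n → Bool} {p q r : Option (Fin n)}
    (hpq : x ∈ halfThrough s p q) (hpr : x ∈ halfThrough s p r) : x ∈ halfThrough s q r := by
  rw [mem_halfThrough_iff] at *
  exact hpq.symm.trans hpr

theorem mem_halfThrough_of_notMem {s x : Fin n → Bool} {p q r : Option (Fin n)}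
    (hpq : x ∉ halfThrough s p q) (hpr : x ∉ halfThrough s p r) : x ∈ halfThrough s q r := by
  rw [mem_halfThrough_iff] at *
  exact Bool.not_inj ((Bool.eq_not_of_ne hpq).symm.trans (Bool.eq_not_of_ne hpr))

theorem exists_mem_halfThrough_inter_ne (hn : 4 ≤ n) (s : Fin n → Bool)
    (p q p' q' : Option (Fin n)) (y z : Fin n → Bool) :
    ∃ x ∈ halfThrough s p q ∩ halfThrough s p' q', x ≠ y ∧ x ≠ z := by
  let ℓ : (Fin n → Bool) →+ Bool × Bool := AddMonoidHom.mk'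
    (fun x => (labelBit p x + labelBit q x, labelBit p' x + labelBit q' x)) fun x y => by
      simp only [labelBit_add, Prod.mk_add_mk, add_add_add_comm]
  have four_le_card_ker : 4 ≤ Nat.card ℓ.ker := by
    have card_range_le : Nat.card ℓ.range ≤ 4 := by
      simpa using Nat.card_le_card_of_injective (Subtype.val : ℓ.range → Bool × Bool)
        Subtype.val_injective
    have card_ker_mul_card_range : Nat.card ℓ.ker * Nat.card ℓ.range = 2 ^ n := by
      rw [← AddSubgroup.index_ker, AddSubgroup.card_mul_index]
      simp
    have : 2 ^ 4 ≤ 2 ^ n := Nat.pow_le_pow_right two_pos hn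
    nlinarith
  have pair_lt_coset : ({y, z} : Set (Fin n → Bool)).ncard <
      ((s + ·) '' (ℓ.ker : Set (Fin n → Bool))).ncard := by
    rw [Set.ncard_image_of_injective _ (add_right_injective s)]
    exact (Set.ncard_insert_le y {z}).trans_lt
      (lt_of_lt_of_le (by simp) four_le_card_ker)
  obtain ⟨_, ⟨k, hk, rfl⟩, hne⟩ := Set.exists_mem_notMem_of_ncard_lt_ncard pair_lt_coset
  have hk' : labelBit p k + labelBit q k = 0 ∧ labelBit p' k + labelBit q' k = 0 :=
    Prod.ext_iff.mp hk
  simp only [Set.mem_insert_iff, Set.mem_singleton_iff, not_or] at hne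
  refine ⟨s + k, ⟨?_, ?_⟩, hne⟩ <;>
    simp only [halfThrough, half, Set.mem_ofPred_eq, labelBit_add]
  · rw [add_add_add_comm, hk'.1, add_zero]
  · rw [add_add_add_comm, hk'.2, add_zero]

theorem IsPointFunctionOn.of_halfThrough (hn : 4 ≤ n) {f : BoolFun n} {s : Fin n → Bool}
    (h : ∀ p q, p ≠ q → IsPointFunctionOn f (halfThrough s p q)) :
    IsPointFunctionOn f Set.univ := by
  choose! a mem_half unique using h
  have value_eq {p q p' q'} (hpq : p ≠ q) (hpq' : p' ≠ q') : f (a p q) = f (a p' q') := by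
    obtain ⟨x, ⟨hx, hx'⟩, hne, hne'⟩ :=
      exists_mem_halfThrough_inter_ne hn s p q p' q' (a p q) (a p' q')
    exact Bool.not_inj ((Bool.eq_not_of_ne (mt (unique p q hpq x hx) hne)).symm.trans
      (Bool.eq_not_of_ne (mt (unique p' q' hpq' x hx') hne')))
  have eq_of_mem {p q p' q'} (hpq : p ≠ q) (hpq' : p' ≠ q')
      (hmem : a p q ∈ halfThrough s p' q') : a p q = a p' q' :=
    unique p' q' hpq' _ hmem (value_eq hpq hpq')
  by_contra hf
  have notMem {p q r} (hpq : p ≠ q) (hpr : p ≠ r) (hqr : q ≠ r) : a p q ∉ halfThrough s p r := by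
    -- The three halves given by `p`, `q`, `r` would cover the cube and share the isolated point.
    intro hmem
    have hpr_eq := eq_of_mem hpq hpr hmem
    have hqr_eq := eq_of_mem hpq hqr (mem_halfThrough_trans (mem_half p q hpq) hmem)
    refine hf ⟨a p q, trivial, fun x _ hx => ?_⟩
    by_cases hxpq : x ∈ halfThrough s p q
    · exact unique p q hpq x hxpq hx
    by_cases hxpr : x ∈ halfThrough s p r
    · exact (unique p r hpr x hxpr (hpr_eq ▸ hx)).trans hpr_eq.symm
    have hxqr := mem_halfThrough_of_notMem hxpq hxpr
    exact (unique q r hqr x hxqr (hqr_eq ▸ hx)).trans hqr_eq.symm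
  obtain ⟨l⟩ : Nonempty (Fin 5 ↪ Option (Fin n)) :=
    Function.Embedding.nonempty_of_card_le (by simpa using hn)
  have ne {i j : Fin 5} (hij : i ≠ j) : l i ≠ l j := l.injective.ne hij
  have mem (i j : Fin 5) (hi : 1 < i) (hj : 1 < j) :
      a (l 0) (l 1) ∈ halfThrough s (l i) (l j) :=
    mem_halfThrough_of_notMem (notMem (ne (by decide)) (ne (by lia)) (ne (by lia)))
      (notMem (ne (by decide)) (ne (by lia)) (ne (by lia)))
  have h23 := eq_of_mem (ne (by decide)) (ne (by decide)) (mem 2 3 (by decide) (by decide))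
  exact notMem (ne (by decide)) (ne (by decide)) (ne (by decide))
    (h23 ▸ mem 2 4 (by decide) (by decide))

end OddHalves

section Isometry

variable {𝕜 m κ : Type*} [RCLike 𝕜] [Fintype m]

theorem sum_norm_sq_eq_star_dotProduct (v : m → 𝕜) :
    ((∑ i, ‖v i‖ ^ 2 : ℝ) : 𝕜) = star v ⬝ᵥ v := by
  simp [dotProduct, RCLike.conj_mul]

theorem sum_norm_sq_mulVec [Fintype κ] [DecidableEq κ] {M : Matrix m κ 𝕜} (hM : Mᴴ * M = 1)
    (v : κ → 𝕜) :
    ∑ i, ‖(M *ᵥ v) i‖ ^ 2 = ∑ j, ‖v j‖ ^ 2 := by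
  apply RCLike.ofReal_injective (K := 𝕜)
  rw [sum_norm_sq_eq_star_dotProduct, sum_norm_sq_eq_star_dotProduct, Matrix.star_mulVec,
    ← Matrix.dotProduct_mulVec, Matrix.mulVec_mulVec, hM, Matrix.one_mulVec]

theorem exists_unitary_extending_isometry [DecidableEq m] [DecidableEq κ] {M : Matrix m κ 𝕜}
    (hM : Mᴴ * M = 1) (e : κ ↪ m) :
    ∃ V : Matrix.unitaryGroup m 𝕜, ∀ i j, (V : Matrix m m 𝕜) i (e j) = M i j := by
  let col : m → EuclideanSpace 𝕜 m :=
    Function.extend e (fun j => WithLp.toLp 2 fun i => M i j) 0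
  have col_apply (j : κ) : col (e j) = WithLp.toLp 2 fun i => M i j :=
    e.injective.extend_apply _ _ j
  have hcol : Orthonormal 𝕜 ((Set.range e).domRestrict col) := by
    rw [orthonormal_iff_ite]
    rintro ⟨_, j, rfl⟩ ⟨_, k, rfl⟩
    have hjk : inner 𝕜 (col (e j)) (col (e k)) = (1 : Matrix κ κ 𝕜) j k := by
      simp only [← hM, col_apply, PiLp.inner_apply, RCLike.inner_apply, Matrix.mul_apply,
        Matrix.conjTranspose_apply, mul_comm, RCLike.star_def]
    simpa [Matrix.one_apply, Subtype.ext_iff] using hjk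
  obtain ⟨b, hb⟩ := hcol.exists_orthonormalBasis_extension_of_card_eq (by simp)
  refine ⟨⟨Matrix.of fun i j => b j i, ?_⟩, fun i j => ?_⟩
  · rw [Matrix.mem_unitaryGroup_iff']
    ext j k
    have hjk := orthonormal_iff_ite.mp b.orthonormal j k
    simpa [Matrix.mul_apply, Matrix.star_apply, Matrix.one_apply, PiLp.inner_apply, mul_comm]
      using hjk
  · simp [hb (e j) ⟨j, rfl⟩, col_apply]

end Isometry

section QueryRun

variable {ι : Type*} [Fintype ι] [DecidableEq ι]

/-- The state reached from `ψ` by alternating the query matrix `D` with the unitaries of the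
list `L`. -/
def queryRun (D : Matrix ι ι ℂ) (L : List (Matrix.unitaryGroup ι ℂ)) (ψ : ι → ℂ) : ι → ℂ :=
  L.foldl (fun φ (U : Matrix.unitaryGroup ι ℂ) => (U : Matrix ι ι ℂ) *ᵥ (D *ᵥ φ)) ψ

theorem queryRun_cons (D : Matrix ι ι ℂ) (U : Matrix.unitaryGroup ι ℂ)
    (L : List (Matrix.unitaryGroup ι ℂ)) (ψ : ι → ℂ) :
    queryRun D (U :: L) ψ = queryRun D L ((U : Matrix ι ι ℂ) *ᵥ (D *ᵥ ψ)) := rfl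

theorem queryRun_smul (D : Matrix ι ι ℂ) (L : List (Matrix.unitaryGroup ι ℂ)) (c : ℂ)
    (ψ : ι → ℂ) : queryRun D L (c • ψ) = c • queryRun D L ψ := by
  induction L generalizing ψ with
  | nil => rfl
  | cons U L ih => simp only [queryRun_cons, Matrix.mulVec_smul, ih]

end QueryRun

section Branch

variable {κ Ω : Type*} {τ : Ω → Type*}

/-- The superposition of the states `ψ o` of the branches `τ o`, vanishing on the control
space `κ`. -/
def branchState (ψ : ∀ o, τ o → ℂ) : κ ⊕ (Σ o, τ o) → ℂ :=
  Sum.elim 0 fun t => ψ t.1 t.2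

/-- The matrix that attaches the state `s o` to each outcome `o` of `W`. -/
def branchMatrix (W : Matrix Ω κ ℂ) (s : ∀ o, τ o → ℂ) : Matrix (κ ⊕ Σ o, τ o) κ ℂ :=
  Matrix.of fun t i => branchState (fun o => W o i • s o) t

theorem branchMatrix_mulVec [Fintype κ] (W : Matrix Ω κ ℂ) (s : ∀ o, τ o → ℂ) (v : κ → ℂ) :
    branchMatrix W s *ᵥ v = branchState fun o => (W *ᵥ v) o • s o := by
  funext t
  rcases t with i | ⟨o, l⟩
  · simp [branchMatrix, branchState, Matrix.mulVec, dotProduct]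
  · simp only [branchMatrix, branchState, Matrix.mulVec, dotProduct, Matrix.of_apply, Sum.elim_inr,
      Pi.smul_apply, smul_eq_mul, Finset.sum_mul, mul_right_comm]

variable [Fintype Ω] [∀ o, Fintype (τ o)]

theorem branchMatrix_conjTranspose_mul_self [Fintype κ] [DecidableEq κ]
    {W : Matrix Ω κ ℂ} (hW : Wᴴ * W = 1)
    {s : ∀ o, τ o → ℂ} (hs : ∀ o, ∑ l, ‖s o l‖ ^ 2 = 1) :
    (branchMatrix W s)ᴴ * branchMatrix W s = 1 := by
  have hs' (o : Ω) : star (s o) ⬝ᵥ s o = 1 := by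
    rw [← sum_norm_sq_eq_star_dotProduct, hs, RCLike.ofReal_one]
  rw [← hW]
  ext i j
  simp only [Matrix.mul_apply, Matrix.conjTranspose_apply, branchMatrix, branchState,
    Matrix.of_apply, Fintype.sum_sum_type, Fintype.sum_sigma, Sum.elim_inl, Sum.elim_inr,
    Pi.zero_apply, Pi.smul_apply, smul_eq_mul, mul_zero, Finset.sum_const_zero, zero_add,
    star_mul', mul_mul_mul_comm, ← Finset.mul_sum]
  refine Finset.sum_congr rfl fun o _ => ?_
  rw [show ∑ l, star (s o l) * s o l = 1 from hs' o, mul_one]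

variable [Fintype κ] [DecidableEq κ] [DecidableEq Ω] [∀ o, DecidableEq (τ o)]

/-- The direct sum of the unitaries `U o`, acting on the branches `τ o`, and the identity on the
control space `κ`. -/
def branchUnitary (U : ∀ o, Matrix.unitaryGroup (τ o) ℂ) :
    Matrix.unitaryGroup (κ ⊕ Σ o, τ o) ℂ :=
  ⟨Matrix.fromBlocks 1 0 0 (Matrix.blockDiagonal' fun o => (U o : Matrix (τ o) (τ o) ℂ)), by
    have hU : (fun o => (U o : Matrix (τ o) (τ o) ℂ) * (U o : Matrix (τ o) (τ o) ℂ)ᴴ) = 1 :=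
      funext fun o => Matrix.mem_unitaryGroup_iff.mp (U o).2
    rw [Matrix.mem_unitaryGroup_iff, Matrix.star_eq_conjTranspose, Matrix.fromBlocks_conjTranspose,
      Matrix.fromBlocks_multiply, Matrix.blockDiagonal'_conjTranspose,
      ← Matrix.blockDiagonal'_mul, hU]
    simp⟩

theorem branchUnitary_mulVec_branchState (U : ∀ o, Matrix.unitaryGroup (τ o) ℂ)
    (ψ : ∀ o, τ o → ℂ) :
    (branchUnitary U).1 *ᵥ branchState (κ := κ) ψ =
      branchState fun o => (U o : Matrix (τ o) (τ o) ℂ) *ᵥ ψ o := by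
  have hblock : (Matrix.blockDiagonal' fun o => (U o : Matrix (τ o) (τ o) ℂ)) *ᵥ
      (fun t => ψ t.1 t.2) = fun t => ((U t.1 : Matrix _ _ ℂ) *ᵥ ψ t.1) t.2 := by
    funext ⟨o, i⟩
    simp only [Matrix.mulVec, dotProduct, Fintype.sum_sigma]
    rw [Fintype.sum_eq_single o fun o' ho' => Finset.sum_eq_zero fun j _ => by
      rw [Matrix.blockDiagonal'_apply_ne _ _ _ ho'.symm, zero_mul]]
    simp only [Matrix.blockDiagonal'_apply_eq]
  simp [branchUnitary, branchState, Matrix.fromBlocks_mulVec, hblock]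

theorem diagonal_mulVec_branchState (d : κ ⊕ (Σ o, τ o) → ℂ) (ψ : ∀ o, τ o → ℂ) :
    Matrix.diagonal d *ᵥ branchState ψ =
      branchState fun o => Matrix.diagonal (fun i => d (Sum.inr ⟨o, i⟩)) *ᵥ ψ o := by
  funext t
  rcases t with i | ⟨o, i⟩ <;> simp [branchState, Matrix.mulVec_diagonal]

theorem exists_queryRun_branchState {X : Type*} (d : X → κ ⊕ (Σ o, τ o) → ℂ) (k : ℕ)
    (L : ∀ o, List (Matrix.unitaryGroup (τ o) ℂ)) (hL : ∀ o, (L o).length = k) :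
    ∃ L' : List (Matrix.unitaryGroup (κ ⊕ Σ o, τ o) ℂ), L'.length = k ∧
      ∀ (x : X) (ψ : ∀ o, τ o → ℂ),
        queryRun (Matrix.diagonal (d x)) L' (branchState ψ) =
          branchState fun o =>
            queryRun (Matrix.diagonal fun i => d x (Sum.inr ⟨o, i⟩)) (L o) (ψ o) := by
  induction k generalizing L with
  | zero =>
    obtain rfl : L = fun _ => [] := funext fun o => List.length_eq_zero_iff.mp (hL o)
    exact ⟨[], rfl, fun _ _ => rfl⟩
  | succ k ih =>
    choose U T hUT using fun o => List.exists_cons_of_length_eq_add_one (hL o)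
    obtain ⟨L', length_eq, run_eq⟩ := ih T fun o => by simpa [hUT] using hL o
    refine ⟨branchUnitary U :: L', by simp [length_eq], fun x ψ => ?_⟩
    simp only [queryRun_cons, diagonal_mulVec_branchState, branchUnitary_mulVec_branchState,
      run_eq, hUT]

end Branch

section Algorithms

variable {n : ℕ}

/-- The sign `(-1)^b`. -/
def bitSign (b : Bool) : ℂ := if b then -1 else 1

theorem bitSign_zero : bitSign 0 = 1 := rfl

theorem bitSign_one : bitSign 1 = -1 := rfl

theorem bitSign_add (a b : Bool) : bitSign (a + b) = bitSign a * bitSign b := by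
  cases a <;> cases b <;> simp [bitSign, Bool.add_eq_xor]

theorem bitSign_add_bitSign_ne_zero_iff {a b : Bool} : bitSign a + bitSign b ≠ 0 ↔ a = b := by
  cases a <;> cases b <;> simp [bitSign]

theorem norm_bitSign (b : Bool) : ‖bitSign b‖ = 1 := by
  cases b <;> simp [bitSign]

namespace QueryAlgorithm

variable {ι : Type} [Fintype ι] [DecidableEq ι]

theorem query_eq_diagonal_bitSign (A : QueryAlgorithm n ι) (x : Fin n → Bool) :
    A.query x = Matrix.diagonal fun i => bitSign (labelBit (A.label i) x) := by
  refine congrArg Matrix.diagonal (funext fun i => ?_)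
  simp only [phase, labelBit, bitSign]
  cases A.label i <;> rfl

theorem finalState_eq_queryRun (A : QueryAlgorithm n ι) (x : Fin n → Bool) :
    A.finalState x =
      queryRun (Matrix.diagonal fun i => bitSign (labelBit (A.label i) x)) A.rest
        (A.first.1 *ᵥ A.start) := by
  rw [← query_eq_diagonal_bitSign]
  rfl

variable {κ Ω : Type} [Fintype κ] [DecidableEq κ] [Fintype Ω] [DecidableEq Ω]
  {τ : Ω → Type} [∀ o, Fintype (τ o)] [∀ o, DecidableEq (τ o)]

/-- Deferred measurement: instead of measuring the outcome `o` of `W` after the first query and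
continuing with `A o`, all the `A o` are run in superposition, on orthogonal subspaces. -/
theorem exists_branch {k : ℕ} (p : κ → Option (Fin n)) {a : κ → ℂ} (ha : ∑ i, ‖a i‖ ^ 2 = 1)
    {W : Matrix Ω κ ℂ} (hW : Wᴴ * W = 1) (A : ∀ o, QueryAlgorithm n (τ o))
    (hA : ∀ o, (A o).queries = k) :
    ∃ B : QueryAlgorithm n (κ ⊕ Σ o, τ o), B.queries = k + 1 ∧
      (∀ o l, B.output (Sum.inr ⟨o, l⟩) = (A o).output l) ∧
      ∀ x, B.finalState x = branchState fun o =>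
        (W *ᵥ fun i => bitSign (labelBit (p i) x) * a i) o • (A o).finalState x := by
  let s (o : Ω) : τ o → ℂ := (A o).first.1 *ᵥ (A o).start
  have hs (o : Ω) : ∑ l, ‖s o l‖ ^ 2 = 1 :=
    (sum_norm_sq_mulVec (Matrix.mem_unitaryGroup_iff'.mp (A o).first.2) _).trans (A o).start_unit
  obtain ⟨V, hV⟩ := exists_unitary_extending_isometry
    (branchMatrix_conjTranspose_mul_self hW hs) Function.Embedding.inl
  have V_mulVec (v : κ → ℂ) : V.1 *ᵥ Sum.elim v 0 = branchState fun o => (W *ᵥ v) o • s o := by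
    rw [← branchMatrix_mulVec]
    funext t
    simpa [Matrix.mulVec, dotProduct, Fintype.sum_sum_type] using
      Finset.sum_congr rfl fun j _ => congrArg (· * v j) (hV t j)
  let label : κ ⊕ (Σ o, τ o) → Option (Fin n) := Sum.elim p fun t => (A t.1).label t.2
  obtain ⟨L, length_eq, run_eq⟩ := exists_queryRun_branchState
    (fun (x : Fin n → Bool) t => bitSign (labelBit (label t) x)) k (fun o => (A o).rest) hA
  let B : QueryAlgorithm n (κ ⊕ Σ o, τ o) :=
    { start := Sum.elim a 0
      start_unit := by simp [ha]
      label := label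
      first := 1
      rest := V :: L
      output := Sum.elim (fun _ => false) fun t => (A t.1).output t.2 }
  refine ⟨B, congrArg (· + 1) length_eq, fun _ _ => rfl, fun x => ?_⟩
  have first_query : Matrix.diagonal (fun t => bitSign (labelBit (label t) x)) *ᵥ Sum.elim a 0 =
      Sum.elim (fun i => bitSign (labelBit (p i) x) * a i) 0 := by
    funext t
    rcases t with i | t <;> simp [Matrix.mulVec_diagonal, label]
  calc B.finalState x
    _ = queryRun (Matrix.diagonal fun t => bitSign (labelBit (label t) x)) L
          (V.1 *ᵥ (Matrix.diagonal (fun t => bitSign (labelBit (label t) x)) *ᵥ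
            Sum.elim a 0)) := by
      rw [finalState_eq_queryRun, queryRun_cons]
      simp only [B, OneMemClass.coe_one, Matrix.one_mulVec]
    _ = _ := by
      rw [first_query, V_mulVec, run_eq]
      simp only [queryRun_smul, finalState_eq_queryRun, label, s, Sum.elim_inr]

theorem outputProb_branch {B : QueryAlgorithm n (κ ⊕ Σ o, τ o)} {A : ∀ o, QueryAlgorithm n (τ o)}
    (output_eq : ∀ o l, B.output (Sum.inr ⟨o, l⟩) = (A o).output l) {x : Fin n → Bool}
    {c : Ω → ℂ} (hB : B.finalState x = branchState fun o => c o • (A o).finalState x) (b : Bool) :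
    B.outputProb x b = ∑ o, ‖c o‖ ^ 2 * (A o).outputProb x b := by
  simp only [outputProb, hB, Finset.sum_filter, Fintype.sum_sum_type, Fintype.sum_sigma,
    branchState, Sum.elim_inl, Sum.elim_inr, output_eq, Pi.zero_apply, Pi.smul_apply, smul_eq_mul,
    norm_mul, mul_pow, norm_zero, ne_eq, OfNat.ofNat_ne_zero, not_false_eq_true, zero_pow,
    ite_self, Finset.sum_const_zero, zero_add, Finset.mul_sum, mul_ite, mul_zero]

end QueryAlgorithm

/-- Some quantum query algorithm with `k` queries computes `f` exactly on the promise that the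
input lies in `S`. -/
def ExactlyComputableOn (k : ℕ) (f : BoolFun n) (S : Set (Fin n → Bool)) : Prop :=
  ∃ (ι : Type) (_ : Fintype ι) (_ : DecidableEq ι) (A : QueryAlgorithm n ι),
    A.queries = k ∧ ∀ x ∈ S, A.outputProb x (f x) = 1

namespace ExactlyComputableOn

variable {k : ℕ} {f g : BoolFun n} {S T : Set (Fin n → Bool)}

theorem congr (hf : ExactlyComputableOn k f S) (hfg : ∀ x ∈ T, x ∈ S ∧ f x = g x) :
    ExactlyComputableOn k g T := by
  obtain ⟨ι, _, _, A, hA, hprob⟩ := hf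
  exact ⟨ι, _, _, A, hA, fun x hx => (hfg x hx).2 ▸ hprob x (hfg x hx).1⟩

theorem of_const {b : Bool} (hf : ∀ x ∈ S, f x = b) : ExactlyComputableOn 0 f S := by
  refine ⟨Unit, inferInstance, inferInstance,
    { start := fun _ => 1, start_unit := by simp, label := fun _ => none, first := 1,
      rest := [], output := fun _ => b }, rfl, fun x hx => ?_⟩
  simp [hf x hx, QueryAlgorithm.outputProb, QueryAlgorithm.finalState]

theorem comp {m : ℕ} {g : BoolFun m} (hg : ExactlyComputableOn k g Set.univ) (e : Fin m → Fin n) :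
    ExactlyComputableOn k (fun x => g (x ∘ e)) Set.univ := by
  obtain ⟨ι, _, _, A, hA, hprob⟩ := hg
  let B : QueryAlgorithm n ι := { A with label := fun i => (A.label i).map e }
  have hB (x : Fin n → Bool) : B.finalState x = A.finalState (x ∘ e) := by
    simp only [QueryAlgorithm.finalState_eq_queryRun, B, labelBit_map]
  refine ⟨ι, _, _, B, hA, fun x _ => ?_⟩
  rw [QueryAlgorithm.outputProb, hB]
  exact hprob (x ∘ e) trivial

theorem branch {κ Ω : Type} [Fintype κ] [DecidableEq κ] [Fintype Ω]
    (p : κ → Option (Fin n)) {a : κ → ℂ} (ha : ∑ i, ‖a i‖ ^ 2 = 1) {W : Matrix Ω κ ℂ}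
    (hW : Wᴴ * W = 1)
    (hf : ∀ o, ExactlyComputableOn k f
      {x ∈ S | (W *ᵥ fun i => bitSign (labelBit (p i) x) * a i) o ≠ 0}) :
    ExactlyComputableOn (k + 1) f S := by
  classical
  choose τ _ _ A queries_eq prob_eq_one using hf
  obtain ⟨B, hB, output_eq, finalState_eq⟩ := QueryAlgorithm.exists_branch p ha hW A queries_eq
  refine ⟨_, _, _, B, hB, fun x hx => ?_⟩
  set c : Ω → ℂ := W *ᵥ fun i => bitSign (labelBit (p i) x) * a i with hc
  calc B.outputProb x (f x)
    _ = ∑ o, ‖c o‖ ^ 2 * (A o).outputProb x (f x) :=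
      QueryAlgorithm.outputProb_branch output_eq (finalState_eq x) _
    _ = ∑ o, ‖c o‖ ^ 2 := by
      refine Finset.sum_congr rfl fun o _ => ?_
      by_cases ho : c o = 0
      · simp [ho]
      · rw [prob_eq_one o x ⟨hx, ho⟩, mul_one]
    _ = 1 := by
      rw [hc, sum_norm_sq_mulVec hW]
      simpa [norm_bitSign] using ha

end ExactlyComputableOn

end Algorithms

section MeanDifference

variable {κ : Type*} [Fintype κ] [DecidableEq κ]

variable (κ) in
/-- The isometry that records the mean of the coordinates of a vector at `none`, and the
difference of the coordinates `i` and `j` at `some (i, j)`, both up to a scalar. -/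
noncomputable def meanDifference : Matrix (Option (κ × κ)) κ ℂ :=
  Matrix.of fun o l => o.elim (((√(Fintype.card κ))⁻¹ : ℝ) : ℂ) fun q =>
    ((√(2 * Fintype.card κ))⁻¹ : ℝ) * ((1 : Matrix κ κ ℂ) q.1 l - (1 : Matrix κ κ ℂ) q.2 l)

theorem meanDifference_mulVec_none (v : κ → ℂ) :
    (meanDifference κ *ᵥ v) none = ((√(Fintype.card κ))⁻¹ : ℝ) * ∑ i, v i := by
  simp only [meanDifference, Matrix.mulVec, dotProduct, Matrix.of_apply, Option.elim_none,
    Finset.mul_sum]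

theorem meanDifference_mulVec_some (v : κ → ℂ) (i j : κ) :
    (meanDifference κ *ᵥ v) (some (i, j)) = ((√(2 * Fintype.card κ))⁻¹ : ℝ) * (v i - v j) := by
  simp [meanDifference, Matrix.mulVec, dotProduct, Matrix.one_apply, mul_assoc, sub_mul,
    ← Finset.mul_sum]

theorem sum_sum_sub_mul_sub {ι R : Type*} [Fintype ι] [CommRing R] (u v : ι → R) :
    ∑ i, ∑ j, (u i - u j) * (v i - v j) =
      2 * Fintype.card ι * ∑ i, u i * v i - 2 * ((∑ i, u i) * ∑ i, v i) := by
  simp only [sub_mul, mul_sub, Finset.sum_sub_distrib, Finset.sum_const, Finset.card_univ,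
    nsmul_eq_mul, ← Finset.mul_sum, ← Finset.sum_mul]
  ring

theorem meanDifference_conjTranspose_mul_self [Nonempty κ] :
    (meanDifference κ)ᴴ * meanDifference κ = 1 := by
  have star_ofReal (r : ℝ) : star (r : ℂ) = r := Complex.conj_ofReal r
  have star_one_apply (i j : κ) : star ((1 : Matrix κ κ ℂ) i j) = (1 : Matrix κ κ ℂ) i j := by
    rw [Matrix.one_apply, apply_ite star, star_one, star_zero]
  have inv_sqrt_mul_self {r : ℝ} (hr : 0 ≤ r) :
      (((√r)⁻¹ : ℝ) : ℂ) * ((√r)⁻¹ : ℝ) = (r⁻¹ : ℝ) := by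
    rw [← Complex.ofReal_mul, ← mul_inv, Real.mul_self_sqrt hr]
  ext k l
  have hcard : (Fintype.card κ : ℂ) ≠ 0 := Nat.cast_ne_zero.mpr Fintype.card_ne_zero
  calc ((meanDifference κ)ᴴ * meanDifference κ) k l
    _ = ((Fintype.card κ : ℝ)⁻¹ : ℝ) + ((2 * Fintype.card κ : ℝ)⁻¹ : ℝ) *
          ∑ i, ∑ j, ((1 : Matrix κ κ ℂ) i k - (1 : Matrix κ κ ℂ) j k) *
            ((1 : Matrix κ κ ℂ) i l - (1 : Matrix κ κ ℂ) j l) := by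
      simp only [Matrix.mul_apply, Fintype.sum_option, Fintype.sum_prod_type, meanDifference,
        Matrix.conjTranspose_apply, Matrix.of_apply, Option.elim_none, Option.elim_some, star_mul',
        star_sub, star_ofReal, star_one_apply, Finset.mul_sum,
        inv_sqrt_mul_self (Nat.cast_nonneg (Fintype.card κ))]
      refine congrArg _ (Finset.sum_congr rfl fun i _ => Finset.sum_congr rfl fun j _ => ?_)
      rw [mul_mul_mul_comm, inv_sqrt_mul_self (by positivity)]
    _ = (1 : Matrix κ κ ℂ) k l := by
      have sum_one_apply (k : κ) : ∑ i, (1 : Matrix κ κ ℂ) i k = 1 := by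
        simp only [Matrix.one_apply, Finset.sum_ite_eq', Finset.mem_univ, if_true]
      have sum_one_apply_mul : ∑ i, (1 : Matrix κ κ ℂ) i k * (1 : Matrix κ κ ℂ) i l =
          (1 : Matrix κ κ ℂ) k l := by
        simp only [Matrix.one_apply (j := k), ite_mul, one_mul, zero_mul, Finset.sum_ite_eq',
          Finset.mem_univ, if_true]
      rw [sum_sum_sub_mul_sub, sum_one_apply, sum_one_apply, sum_one_apply_mul]
      push_cast
      field_simp
      ring

end MeanDifference

section Literals

variable {n k : ℕ} {f : BoolFun n} {S : Set (Fin n → Bool)}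

namespace ExactlyComputableOn

theorem of_literals {κ : Type} [Fintype κ] [Nonempty κ] (p : κ → Option (Fin n)) (e : κ → Bool)
    (hmean : ExactlyComputableOn k f {x ∈ S | ∑ i, bitSign (e i + labelBit (p i) x) ≠ 0})
    (hdiff : ∀ i j, i ≠ j →
      ExactlyComputableOn k f {x ∈ S | e i + labelBit (p i) x ≠ e j + labelBit (p j) x}) :
    ExactlyComputableOn (k + 1) f S := by
  classical
  have hcard : (0 : ℝ) < Fintype.card κ := Nat.cast_pos.mpr Fintype.card_pos
  let c : ℂ := ((√(Fintype.card κ))⁻¹ : ℝ)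
  have norm_sq_c : ‖c‖ ^ 2 = (Fintype.card κ : ℝ)⁻¹ := by
    rw [Complex.norm_real, Real.norm_eq_abs, sq_abs, inv_pow, Real.sq_sqrt hcard.le]
  have unit : ∑ i, ‖bitSign (e i) * c‖ ^ 2 = 1 := by
    simp only [norm_mul, norm_bitSign, one_mul, norm_sq_c, Finset.sum_const, Finset.card_univ,
      nsmul_eq_mul, mul_inv_cancel₀ hcard.ne']
  have queried (x : Fin n → Bool) : (fun i => bitSign (labelBit (p i) x) * (bitSign (e i) * c)) =
      fun i => bitSign (e i + labelBit (p i) x) * c := by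
    funext i
    rw [bitSign_add]
    ring
  refine branch p unit meanDifference_conjTranspose_mul_self fun o => ?_
  simp only [queried]
  rcases o with _ | ⟨i, j⟩
  · refine hmean.congr fun x hx => ⟨⟨hx.1, fun h => hx.2 ?_⟩, rfl⟩
    rw [meanDifference_mulVec_none, ← Finset.sum_mul, h, zero_mul, mul_zero]
  · have amplitude_ne {x : Fin n → Bool} (hx : (meanDifference κ *ᵥ
        fun i => bitSign (e i + labelBit (p i) x) * c) (some (i, j)) ≠ 0) :
        e i + labelBit (p i) x ≠ e j + labelBit (p j) x := by
      intro h
      rw [meanDifference_mulVec_some, h, sub_self, mul_zero] at hx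
      exact hx rfl
    by_cases hij : i = j
    · exact hmean.congr fun x hx => absurd (by rw [hij]) (amplitude_ne hx.2)
    · exact (hdiff i j hij).congr fun x hx => ⟨⟨hx.1, amplitude_ne hx.2⟩, rfl⟩

theorem of_half (p q : Option (Fin n)) (h : ∀ b, ExactlyComputableOn k f (S ∩ half p q b)) :
    ExactlyComputableOn (k + 1) f S := by
  refine of_literals (κ := Fin 2) ![p, q] 0 ((h 0).congr fun x hx => ⟨⟨hx.1, ?_⟩, rfl⟩)
    fun i j hij => (h 1).congr fun x hx => ⟨⟨hx.1, ?_⟩, rfl⟩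
  · have bits_eq : labelBit p x = labelBit q x := by
      simpa [bitSign_add_bitSign_ne_zero_iff] using hx.2
    exact (congrArg (· + labelBit q x) bits_eq).trans (BooleanRing.add_self _)
  · have bits_ne : labelBit p x ≠ labelBit q x := by
      have := hx.2
      fin_cases i <;> fin_cases j <;> simp_all [eq_comm]
    exact Bool.xor_iff_ne.mpr bits_ne

end ExactlyComputableOn

end Literals

section Halves

variable {n : ℕ}

theorem exists_boolFun_of_half {p q : Option (Fin (n + 1))} (hpq : p ≠ q) (f : BoolFun (n + 1))
    (b : Bool) : ∃ g : BoolFun n, ∑ y, g y = ∑ x : half p q b, f x ∧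
      (IsPointFunctionOn g Set.univ → IsPointFunctionOn f (half p q b)) ∧
      ∀ k, ExactlyComputableOn k g Set.univ → ExactlyComputableOn k f (half p q b) := by
  obtain ⟨e, he⟩ := exists_half_equiv hpq
  obtain ⟨E, hE⟩ := he b
  refine ⟨fun y => f (E.symm y), E.symm.sum_comp fun x => f x, isPointFunctionOn_of_comp_equiv E,
    fun k hg => (hg.comp e).congr fun x hx => ⟨trivial, ?_⟩⟩
  rw [← hE ⟨x, hx⟩, Equiv.symm_apply_apply]

theorem exactlyComputableOn_univ_of_sum_eq_zero (f : BoolFun (n + 1)) (hf : ∑ x, f x = 0) :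
    ExactlyComputableOn n f Set.univ := by
  induction n with
  | zero =>
    rw [← (Equiv.funUnique (Fin 1) Bool).symm.sum_comp, Fintype.sum_bool] at hf
    refine .of_const (b := f 0) fun x _ => ?_
    obtain ⟨b, rfl⟩ := (Equiv.funUnique (Fin 1) Bool).symm.surjective x
    cases b
    · rfl
    · exact (BooleanRing.add_eq_zero' _ _).mp hf
  | succ n ih =>
    obtain ⟨p, q, hpq, supportSum_eq⟩ := Fintype.exists_ne_map_eq_of_card_lt
      (fun p => labelBit p (supportSum f)) (by simp)
    refine .of_half p q fun b => ?_
    obtain ⟨g, sum_g, -, hg⟩ := exists_boolFun_of_half hpq f b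
    rw [Set.univ_inter]
    refine hg n (ih g ?_)
    rw [sum_g, sum_half, hf, mul_zero, zero_add, supportSum_eq, BooleanRing.add_self]

theorem exactlyComputableOn_compl_halfThrough_of_sum_eq_one {f : BoolFun (n + 2)}
    (hf : ∑ x, f x = 1) {p q : Option (Fin (n + 2))} (hpq : p ≠ q) :
    ExactlyComputableOn n f (halfThrough (supportSum f) p q)ᶜ := by
  rw [halfThrough, compl_half]
  obtain ⟨g, sum_g, -, hg⟩ := exists_boolFun_of_half hpq f
    (1 + (labelBit p (supportSum f) + labelBit q (supportSum f)))
  refine hg n (exactlyComputableOn_univ_of_sum_eq_zero g ?_)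
  rw [sum_g, sum_half, hf]
  generalize labelBit p (supportSum f) + labelBit q (supportSum f) = c
  decide +revert

theorem ExactlyComputableOn.of_halfThrough {f : BoolFun (n + 2)} (hf : ∑ x, f x = 1)
    {p q : Option (Fin (n + 2))} (hpq : p ≠ q)
    (h : ExactlyComputableOn n f (halfThrough (supportSum f) p q)) :
    ExactlyComputableOn (n + 1) f Set.univ := by
  refine .of_half p q fun b => ?_
  by_cases hb : b = labelBit p (supportSum f) + labelBit q (supportSum f)
  · exact h.congr fun x hx => ⟨hx.2.trans hb, rfl⟩
  · exact (exactlyComputableOn_compl_halfThrough_of_sum_eq_one hf hpq).congr fun x hx =>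
      ⟨fun hx' => hb (hx.2.symm.trans hx'), rfl⟩

end Halves

section ThreeBits

theorem supportSum_comp_add_right {n : ℕ} (f : BoolFun n) (a : Fin n → Bool) (i : Fin n) :
    supportSum (fun y => f (y + a)) i = supportSum f i + (∑ x, f x) * a i := by
  simp only [supportSum, Finset.sum_mul, ← Finset.sum_add_distrib, ← mul_add]
  rw [← Equiv.sum_comp (Equiv.addRight a) fun x => f x * (x i + a i)]
  refine Finset.sum_congr rfl fun x _ => ?_
  simp only [Equiv.coe_addRight, Pi.add_apply, add_assoc, BooleanRing.add_self, add_zero]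

theorem eq_zero_or_single_or_one_add_single_or_one (y : Fin 3 → Bool) :
    y = 0 ∨ (∃ i, y = Pi.single i 1) ∨ (∃ i, y = 1 + Pi.single i 1) ∨ y = 1 := by
  decide +revert

theorem sum_cube_three {M : Type*} [AddCommMonoid M] (h : (Fin 3 → Bool) → M) :
    ∑ x, h x = h 0 + ∑ i, h (Pi.single i 1) + ∑ i, h (1 + Pi.single i 1) + h 1 := by
  have univ_eq : (Finset.univ : Finset (Fin 3 → Bool)).val = {0} +
      Finset.univ.val.map (fun i => Pi.single i 1) +
      Finset.univ.val.map (fun i => 1 + Pi.single i 1) + {1} := by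
    decide
  rw [Finset.sum, univ_eq]
  simp only [Multiset.map_add, Multiset.sum_add, Multiset.map_singleton, Multiset.sum_singleton,
    Multiset.map_map]
  rfl

theorem sum_bitSign_labelBit_one_add_single (i : Fin 3) :
    ∑ p : Option (Fin 3), bitSign (labelBit p (1 + Pi.single i 1)) = 0 := by
  rw [Fintype.sum_option, Fin.sum_univ_three]
  fin_cases i <;> simp [labelBit, bitSign_zero, bitSign_one, BooleanRing.add_self]

theorem supportSum_three (g : BoolFun 3) (i : Fin 3) : supportSum g i =
    g (Pi.single i 1) + (∑ j, g (1 + Pi.single j 1) + g (1 + Pi.single i 1)) + g 1 := by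
  rw [supportSum, sum_cube_three]
  simp [mul_add, Finset.sum_add_distrib, Pi.single_apply]

variable {g : BoolFun 3}

theorem apply_one_of_supportSum_eq_zero (hs : supportSum g = 0) :
    g 1 = ∑ i, g (Pi.single i 1) := by
  have g_single (i) : g (Pi.single i 1) =
      ∑ j, g (1 + Pi.single j 1) + g (1 + Pi.single i 1) + g 1 := by
    rw [← BooleanRing.add_eq_zero', ← add_assoc, ← supportSum_three, hs, Pi.zero_apply]
  simp only [g_single, Fin.sum_univ_three]
  generalize g 1 = t, g (1 + Pi.single 0 1) = a, g (1 + Pi.single 1 1) = b,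
    g (1 + Pi.single 2 1) = c
  clear hs g_single
  decide +revert

theorem eq_affine_of_supportSum_eq_zero (hs : supportSum g = 0) {y : Fin 3 → Bool}
    (hy : ∑ p : Option (Fin 3), bitSign (labelBit p y) ≠ 0) :
    g y = g 0 + ∑ i, (g (Pi.single i 1) + g 0) * y i := by
  rcases eq_zero_or_single_or_one_add_single_or_one y with rfl | ⟨i, rfl⟩ | ⟨i, rfl⟩ | rfl
  · simp
  · simp only [Pi.single_apply, mul_ite, mul_one, mul_zero, Finset.sum_ite_eq', Finset.mem_univ,
      if_true]
    rw [add_comm (g (Pi.single i 1)), ← add_assoc, BooleanRing.add_self, zero_add]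
  · exact absurd (sum_bitSign_labelBit_one_add_single i) hy
  · simp only [apply_one_of_supportSum_eq_zero hs, Fin.sum_univ_three, Pi.one_apply, mul_one]
    generalize g (Pi.single 0 1) = a, g (Pi.single 1 1) = b, g (Pi.single 2 1) = c, g 0 = d
    clear hs hy
    decide +revert

theorem isPointFunctionOn_of_forall_single_ne (hg : ∑ x, g x = 1) (hs : supportSum g = 0)
    (h : ∀ i, g (Pi.single i 1) ≠ g 0) : IsPointFunctionOn g Set.univ := by
  have one_add_ne (b : Bool) : 1 + b ≠ b := by decide +revert
  have eq_of_ne {a b : Bool} (hab : a ≠ b) : a = 1 + b := by decide +revert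
  have g_single (i) : g (Pi.single i 1) = 1 + g 0 := eq_of_ne (h i)
  have g_one : g 1 = 1 + g 0 := by
    rw [apply_one_of_supportSum_eq_zero hs, Fin.sum_univ_three, g_single, g_single, g_single,
      BooleanRing.add_self, zero_add]
  have sum_one_add_single : ∑ i, g (1 + Pi.single i 1) = 1 + g 0 := by
    simp only [sum_cube_three, g_single, g_one, Fin.sum_univ_three (fun _ : Fin 3 => 1 + g 0)] at hg
    revert hg
    generalize ∑ i, g (1 + Pi.single i 1) = t, g 0 = c
    decide +revert
  have g_one_add_single (i) : g (1 + Pi.single i 1) = 1 + g 0 := by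
    have supportSum_apply := (supportSum_three g i).symm.trans (congrFun hs i)
    rw [sum_one_add_single, g_single, g_one, Pi.zero_apply] at supportSum_apply
    revert supportSum_apply
    generalize g (1 + Pi.single i 1) = t, g 0 = c
    decide +revert
  refine ⟨0, trivial, fun y _ hy => ?_⟩
  rcases eq_zero_or_single_or_one_add_single_or_one y with rfl | ⟨i, rfl⟩ | ⟨i, rfl⟩ | rfl
  · rfl
  · exact absurd ((g_single i).symm.trans hy) (one_add_ne _)
  · exact absurd ((g_one_add_single i).symm.trans hy) (one_add_ne _)
  · exact absurd (g_one.symm.trans hy) (one_add_ne _)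

theorem exists_labels_of_supportSum_eq_zero (hg : ∑ x, g x = 1) (hs : supportSum g = 0)
    (hpoint : ¬ IsPointFunctionOn g Set.univ) :
    ∃ p q : Option (Fin 3), ∀ y, ∑ i : Option (Fin 3), bitSign (labelBit i y) ≠ 0 →
      g y = g 0 + (labelBit p y + labelBit q y) := by
  have ⟨j, hj⟩ : ∃ j, g (Pi.single j 1) = g 0 := by
    by_contra! h
    exact hpoint (isPointFunctionOn_of_forall_single_ne hg hs h)
  have exists_label (c : Bool) (i : Fin 3) : ∃ p, ∀ y, labelBit p y = c * y i := by
    cases c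
    · exact ⟨none, fun y => (zero_mul _).symm⟩
    · exact ⟨some i, fun y => (one_mul _).symm⟩
  choose label hlabel using exists_label
  refine ⟨label (g (Pi.single (j.succAbove 0) 1) + g 0) (j.succAbove 0),
    label (g (Pi.single (j.succAbove 1) 1) + g 0) (j.succAbove 1), fun y hy => ?_⟩
  rw [eq_affine_of_supportSum_eq_zero hs hy, Fin.sum_univ_succAbove _ j, hj, BooleanRing.add_self,
    zero_mul, zero_add, Fin.sum_univ_two, hlabel, hlabel]

theorem exactlyComputableOn_univ_three {f : BoolFun 3} (hf : ∑ x, f x = 1)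
    (hpoint : ¬ IsPointFunctionOn f Set.univ) : ExactlyComputableOn 2 f Set.univ := by
  set s := supportSum f with hs
  have supportSum_translate : supportSum (fun y => f (y + s)) = 0 := by
    funext i
    rw [supportSum_comp_add_right, hf, ← hs, one_mul, BooleanRing.add_self, Pi.zero_apply]
  obtain ⟨p, q, hpq⟩ := exists_labels_of_supportSum_eq_zero (g := fun y => f (y + s))
    ((Equiv.sum_comp (Equiv.addRight s) f).trans hf) supportSum_translate
    (mt (isPointFunctionOn_of_comp_equiv ((Equiv.Set.univ _).trans (Equiv.subRight s))) hpoint)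
  refine .of_literals (κ := Option (Fin 3)) id (fun i => labelBit i s) (.of_half p q fun b => ?_)
    fun i j hij => ?_
  · refine .of_const (b := f s + (b + (labelBit p s + labelBit q s))) fun x hx => ?_
    obtain ⟨⟨-, sum_ne_zero⟩, hb⟩ := hx
    simp only [id, ← labelBit_add, add_comm s] at sum_ne_zero
    calc f x
      _ = f (x + s + s) := by
        rw [add_assoc, show s + s = 0 from funext fun _ => BooleanRing.add_self _, add_zero]
      _ = f (0 + s) + (labelBit p (x + s) + labelBit q (x + s)) := hpq (x + s) sum_ne_zero
      _ = _ := by rw [zero_add, labelBit_add, labelBit_add, add_add_add_comm, hb]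
  · refine (exactlyComputableOn_compl_halfThrough_of_sum_eq_one hf hij).congr fun x hx =>
      ⟨fun hmem => hx.2 ?_, rfl⟩
    simpa only [id, ← labelBit_add, add_comm s] using mem_halfThrough_iff.mp hmem

end ThreeBits

theorem exactlyComputableOn_univ_of_not_isPointFunctionOn (n : ℕ) (f : BoolFun (n + 3))
    (hf : ¬ IsPointFunctionOn f Set.univ) : ExactlyComputableOn (n + 2) f Set.univ := by
  obtain even | odd : ∑ x, f x = 0 ∨ ∑ x, f x = 1 := (Bool.eq_false_or_eq_true _).symm
  · exact exactlyComputableOn_univ_of_sum_eq_zero f even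
  induction n with
  | zero => exact exactlyComputableOn_univ_three odd hf
  | succ n ih =>
    obtain ⟨p, q, hpq, hhalf⟩ : ∃ p q, p ≠ q ∧
        ¬ IsPointFunctionOn f (halfThrough (supportSum f) p q) := by
      by_contra! h
      exact hf (.of_halfThrough (by lia) h)
    obtain ⟨g, sum_g, point_of_point, hg⟩ := exists_boolFun_of_half hpq f
      (labelBit p (supportSum f) + labelBit q (supportSum f))
    refine .of_halfThrough odd hpq (hg _ (ih g (mt point_of_point hhalf) ?_))
    rw [sum_g, sum_half, odd, mul_one, add_assoc, BooleanRing.add_self, add_zero]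

section Complexity

variable {n : ℕ}

theorem ExactlyComputableOn.exactQuantumQueryComplexity_le {k : ℕ} {f : BoolFun n}
    (hf : ExactlyComputableOn k f Set.univ) : exactQuantumQueryComplexity f ≤ k := by
  obtain ⟨ι, _, _, A, rfl, hA⟩ := hf
  exact sInf_le ⟨ι, _, _, A, fun x => hA x trivial, rfl⟩

theorem isPointFunctionOn_univ_of_le_exactQuantumQueryComplexity (hn : 3 ≤ n) {f : BoolFun n}
    (hf : n ≤ exactQuantumQueryComplexity f) : IsPointFunctionOn f Set.univ := by
  obtain ⟨m, rfl⟩ := Nat.exists_eq_add_of_le' hn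
  by_contra h
  have le_pred := hf.trans
    (exactlyComputableOn_univ_of_not_isPointFunctionOn m f h).exactQuantumQueryComplexity_le
  exact absurd (Nat.cast_le.mp le_pred) (by lia)

theorem queryIsomorphic_andFun_iff {f : BoolFun n} :
    QueryIsomorphic f (andFun n) ↔ IsPointFunctionOn f Set.univ := by
  have xor_eq_true_iff (u v : Bool) : xor u v = true ↔ v = !u := by decide +revert
  have andFun_xor (σ : Equiv.Perm (Fin n)) (a x : Fin n → Bool) :
      andFun n (fun i => xor (a i) (x (σ i))) = decide (x = fun i => !(a (σ.symm i))) := by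
    rw [andFun, decide_eq_decide, funext_iff,
      ← σ.forall_congr_right (q := fun i => x i = !(a (σ.symm i)))]
    simp only [xor_eq_true_iff, Equiv.symm_apply_apply]
  rw [isPointFunctionOn_univ_iff]
  constructor
  · rintro ⟨σ, a, b, h⟩
    exact ⟨fun i => !(a (σ.symm i)), b, funext fun x => by rw [h, andFun_xor]⟩
  · rintro ⟨a, b, rfl⟩
    refine ⟨1, fun i => !(a i), b, fun x => ?_⟩
    have andFun_eq := andFun_xor 1 (fun i => !(a i)) x
    simp only [Bool.not_not] at andFun_eq
    exact congrArg (xor b) andFun_eq.symm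

end Complexity

section Fraction

theorem card_boolFun (n : ℕ) : Nat.card (BoolFun n) = 2 ^ 2 ^ n := by
  simp [BoolFun]

theorem card_boolFun_isPointFunctionOn_univ {n : ℕ} (hn : 2 ≤ n) :
    Nat.card {f : BoolFun n // IsPointFunctionOn f Set.univ} = 2 * 2 ^ n := by
  have card_cube : Fintype.card (Fin n → Bool) = 2 ^ n := by simp
  rw [card_isPointFunctionOn_univ, card_cube]
  calc 2 < 2 ^ 2 := by norm_num
    _ ≤ 2 ^ n := Nat.pow_le_pow_right two_pos hn
    _ = _ := card_cube.symm

theorem fractionOf_nonneg (n : ℕ) (P : BoolFun n → Prop) : 0 ≤ fractionOf n P :=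
  div_nonneg (Nat.cast_nonneg _) (Nat.cast_nonneg _)

theorem fractionOf_mono {n : ℕ} {P Q : BoolFun n → Prop} (h : ∀ f, P f → Q f) :
    fractionOf n P ≤ fractionOf n Q := by
  unfold fractionOf
  gcongr
  exact Nat.card_le_card_of_injective _ (Subtype.map_injective h Function.injective_id)

theorem fractionOf_not (n : ℕ) (P : BoolFun n → Prop) :
    fractionOf n (fun f => ¬ P f) = 1 - fractionOf n P := by
  classical
  rw [eq_sub_iff_add_eq', fractionOf, fractionOf, ← add_div, ← Nat.cast_add, ← Nat.card_sum,
    Nat.card_congr (Equiv.sumCompl P), div_self (Nat.cast_ne_zero.mpr Nat.card_pos.ne')]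

theorem tendsto_fractionOf_isPointFunctionOn_univ :
    Filter.Tendsto (fun n : ℕ => fractionOf n fun f => IsPointFunctionOn f Set.univ)
      Filter.atTop (nhds 0) := by
  have div_two_pow : Filter.Tendsto (fun m : ℕ => 2 * ((m : ℝ) ^ 1 / 2 ^ m))
      Filter.atTop (nhds 0) := by
    simpa using (tendsto_pow_const_div_const_pow_of_one_lt 1 one_lt_two).const_mul (2 : ℝ)
  refine (div_two_pow.comp (tendsto_pow_atTop_atTop_of_one_lt one_lt_two)).congr' ?_
  filter_upwards [Filter.eventually_ge_atTop 2] with n hn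
  rw [fractionOf, card_boolFun_isPointFunctionOn_univ hn, card_boolFun, Function.comp_apply]
  push_cast
  ring

theorem tendsto_fractionOf_exactQuantumQueryComplexity_ge :
    Filter.Tendsto (fun n : ℕ => fractionOf n fun f => n ≤ exactQuantumQueryComplexity f)
      Filter.atTop (nhds 0) := by
  refine squeeze_zero' (.of_forall fun n => fractionOf_nonneg n _) ?_
    tendsto_fractionOf_isPointFunctionOn_univ
  filter_upwards [Filter.eventually_ge_atTop 3] with n hn
  exact fractionOf_mono fun f => isPointFunctionOn_univ_of_le_exactQuantumQueryComplexity hn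

end Fraction

theorem mainTheorem2 :
    -- almost all `n`-bit Boolean functions have `Q_E(f) < n`
    Filter.Tendsto
      (fun n : ℕ => fractionOf n (fun f => exactQuantumQueryComplexity f < (n : ℕ∞)))
      Filter.atTop (nhds 1) ∧
    -- the fraction of those with `Q_E(f) = n` is `o(1)`
    Filter.Tendsto
      (fun n : ℕ => fractionOf n (fun f => exactQuantumQueryComplexity f = (n : ℕ∞)))
      Filter.atTop (nhds 0) ∧
    -- there are `2^(2^n)` functions, of which `2 * 2^n` are isomorphic to `AND_n`
    (∀ n : ℕ, Nat.card (BoolFun n) = 2 ^ 2 ^ n) ∧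
    (∀ n : ℕ, 2 ≤ n →
      Nat.card {f : BoolFun n // QueryIsomorphic f (andFun n)} = 2 * 2 ^ n) ∧
    -- so that the fraction of functions isomorphic to `AND_n` is `o(1)`
    Filter.Tendsto
      (fun n : ℕ => fractionOf n (fun f => QueryIsomorphic f (andFun n)))
      Filter.atTop (nhds 0) := by
  refine ⟨?_, ?_, card_boolFun, fun n hn => ?_, ?_⟩
  · simpa only [← not_le, fractionOf_not, sub_zero] using
      tendsto_fractionOf_exactQuantumQueryComplexity_ge.const_sub 1
  · exact squeeze_zero (fun n => fractionOf_nonneg n _) (fun n => fractionOf_mono fun f hf => hf.ge)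
      tendsto_fractionOf_exactQuantumQueryComplexity_ge
  · simpa only [queryIsomorphic_andFun_iff] using card_boolFun_isPointFunctionOn_univ hn
  · simpa only [queryIsomorphic_andFun_iff] using tendsto_fractionOf_isPointFunctionOn_univ
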